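/- Let $(p_k)_{k\ge 1}$ be real numbers with $0\le p_k<1$ such that - [C1] $0<p_1<1$, and - [C2] $\sum_{k=1}^\infty (1-p_1)(1-p_2)\cdots(1-p_k)<\infty$. Let $(\alpha_{i,j})_{i,j\in\mathbb Z,\ i<j}$ be independent random variables on a probability space with $$\mathbb P(\alpha_{i,j}=1)=1-\mathbb P(\alpha_{i,j}=-\infty)=p_{j-i},$$ and let $G$ be the random directed graph on $\mathbb Z$ in which $(i,j)$, $i<j$, is an edge if and only if $\alpha_{i,j}=1$. A path from $i$ to $j$ is an increasing sequence $i=i_0<i_1<\cdots<i_\ell=j$ of integers in which every $(i_{k-1},i_k)$ is an edge; its length is $\ell$. Let $T[i,j]$ be the maximal length of all paths from $i$ to $j$ (with $T[i,j]=0$ if there is none), and let $L[i,j]=\max_{i\le i'\le j'\le j}T[i',j']$. Then there is a deterministic constant $C\in[0,1]$, depending only on $(p_k)_{k\ge1}$, such that, as $n\to\infty$, almost surely $$\frac{L[0,n]}{n}\to C\qquad\text{and}\qquad \frac{T[0,n]}{n}\to C .$$ -/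

import Mathlib

open MeasureTheory ProbabilityTheory Filter Topology

namespace LineModel

/-- Weights `a i j` live on pairs of integers and only the values at `i < j` matter; the pair
`i < j` is an edge when `a i j = 1` (and there is no edge when `a i j = -∞`). The tuple
`(v 0, …, v ℓ)` is a path when it is increasing and its successive vertices are joined by edges.
Its length is the number `ℓ` of its edges. -/
def IsPath (a : ℤ → ℤ → EReal) {ℓ : ℕ} (v : Fin (ℓ + 1) → ℤ) : Prop :=
  ∀ k : Fin ℓ, v k.castSucc < v k.succ ∧ a (v k.castSucc) (v k.succ) = 1

/-- The set of the lengths of all paths from `i` to `j`. -/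
def pathLengths (a : ℤ → ℤ → EReal) (i j : ℤ) : Set ℕ :=
  {ℓ | ∃ v : Fin (ℓ + 1) → ℤ, IsPath a v ∧ v 0 = i ∧ v (Fin.last ℓ) = j}

/-- A path from `i` to `j` has at most `j - i` edges, so the supremum in `T` below is that of a
bounded set. -/
theorem bddAbove_pathLengths (a : ℤ → ℤ → EReal) (i j : ℤ) :
    BddAbove (pathLengths a i j) := by
  refine ⟨(j - i).toNat, ?_⟩
  rintro ℓ ⟨v, hv, h0, hl⟩
  have key : ∀ k : Fin (ℓ + 1), v 0 + (k : ℕ) ≤ v k := by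
    intro k
    induction k using Fin.induction with
    | zero => simp
    | succ k ih =>
      have := (hv k).1
      simp only [Fin.val_castSucc, Fin.val_succ] at ih ⊢
      push_cast
      omega
  have := key (Fin.last ℓ)
  simp only [Fin.val_last] at this
  omega

/-- `T[i,j]`: the maximal length of all paths from `i` to `j`; it is `0` when there is no path
from `i` to `j`. -/
noncomputable def T (a : ℤ → ℤ → EReal) (i j : ℤ) : ℕ := sSup (pathLengths a i j)

/-- `L[i,j]`: the maximum of `T[i',j']` over `i ≤ i' ≤ j' ≤ j`. -/
noncomputable def L (a : ℤ → ℤ → EReal) (i j : ℤ) : ℕ :=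
  (Finset.Icc i j).sup fun i' => (Finset.Icc i' j).sup fun j' => T a i' j'

/-- The random weights `α i j`, `i < j`, of the line model with connection probabilities
`p 1, p 2, …` : they are independent random variables with
`P(α i j = 1) = p (j - i)` and `P(α i j = -∞) = 1 - p (j - i)`. -/
structure IsLineModel (p : ℕ → ℝ) {Ω : Type*} [MeasurableSpace Ω] (P : Measure Ω)
    (α : ℤ → ℤ → Ω → EReal) : Prop where
  measurable : ∀ i j : ℤ, i < j → Measurable (α i j)
  indep : iIndepFun (fun (e : {e : ℤ × ℤ // e.1 < e.2}) => α e.1.1 e.1.2) P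
  prob_one : ∀ i j : ℤ, i < j → P {ω | α i j ω = 1} = ENNReal.ofReal (p (j - i).toNat)
  prob_bot : ∀ i j : ℤ, i < j → P {ω | α i j ω = ⊥} = ENNReal.ofReal (1 - p (j - i).toNat)

end LineModel

/-! Cutting a path at a vertex loses at most one edge, so `L + 1` is subadditive over adjacent
intervals. It is also translation covariant and depends only on the edges inside its interval. A
subadditive ergodic theorem for such local processes (`LocalSubadditive.tendsto_div`) gives the
limit of `L[0,n]/n`. The upper bound comes from the law of large numbers over blocks of fixed
length, which use disjoint sets of edges. The lower bound comes from a greedy covering by intervals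
on which the process is near its lower growth rate.

For `T`, call `t` good in an interval if paths join `t` to every later point and every earlier point
to `t`; `Good` is a local form of this. Between two good points `s ≤ t`, an optimal path of `[s,t]`
extends to a path joining the two ends of the interval, so `L - T` is at most the length cut off
outside `[s,t]`, plus 2 (`L_le_T_of_good`). A point is good with probability bounded below
(`exists_le_modelLaw_good`). The number of good points is again a local subadditive process, hence
has a positive rate. Comparing its values on `[0,n]` and on slightly shorter intervals puts good
points close to both ends, whence `L - T = o(n)`.

All this is done on the product space of edge configurations, whose law depends only on `p`, and is
then pulled back to an arbitrary model. -/

namespace LineModel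

/-! ### Paths, recursively -/

/-- `Conn a ℓ i j` says that there is a path with `ℓ` edges from `i` to `j`. -/
def Conn (a : ℤ → ℤ → EReal) : ℕ → ℤ → ℤ → Prop
  | 0, i, j => i = j
  | ℓ + 1, i, k => ∃ j, Conn a ℓ i j ∧ j < k ∧ a j k = 1

variable {a b : ℤ → ℤ → EReal}

theorem mem_pathLengths_iff_conn {ℓ : ℕ} {i j : ℤ} : ℓ ∈ pathLengths a i j ↔ Conn a ℓ i j := by
  induction ℓ generalizing j with
  | zero =>
    constructor
    · rintro ⟨v, -, h0, h1⟩
      exact h0.symm.trans h1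
    · intro h
      exact ⟨fun _ => i, fun k => k.elim0, rfl, h⟩
  | succ ℓ ih =>
    constructor
    · rintro ⟨v, hv, h0, h1⟩
      refine ⟨v (Fin.last ℓ).castSucc, ih.1 ⟨fun k => v k.castSucc, fun k => ?_, ?_, rfl⟩, ?_⟩
      · exact hv k.castSucc
      · simpa using h0
      · have := hv (Fin.last ℓ)
        rw [Fin.succ_last, h1] at this
        exact this
    · rintro ⟨m, hm, hlt, ha⟩
      obtain ⟨v, hv, h0, h1⟩ := ih.2 hm
      refine ⟨Fin.snoc (α := fun _ => ℤ) v j, ?_, ?_, ?_⟩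
      · intro k
        induction k using Fin.lastCases with
        | last =>
          rw [Fin.snoc_castSucc, Fin.succ_last, Fin.snoc_last, h1]
          exact ⟨hlt, ha⟩
        | cast k =>
          rw [Fin.snoc_castSucc, ← Fin.castSucc_succ, Fin.snoc_castSucc]
          exact hv k
      · rw [← Fin.castSucc_zero, Fin.snoc_castSucc]
        exact h0
      · rw [Fin.snoc_last]

theorem Conn.add_le {ℓ : ℕ} {i j : ℤ} (h : Conn a ℓ i j) : i + ℓ ≤ j := by
  induction ℓ generalizing j with
  | zero => simpa [Conn] using le_of_eq h
  | succ ℓ ih =>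
    obtain ⟨m, hm, hlt, -⟩ := h
    have := ih hm
    push_cast
    omega

theorem Conn.trans {ℓ m : ℕ} {i j k : ℤ} (h : Conn a ℓ i j) (h' : Conn a m j k) :
    Conn a (ℓ + m) i k := by
  induction m generalizing k with
  | zero =>
    obtain rfl : j = k := h'
    exact h
  | succ m ih =>
    obtain ⟨u, hu, hlt, ha⟩ := h'
    exact ⟨u, ih hu, hlt, ha⟩

theorem Conn.congr {ℓ : ℕ} {i j : ℤ} (h : Conn a ℓ i j)
    (hab : ∀ u v, i ≤ u → u < v → v ≤ j → a u v = 1 → b u v = 1) : Conn b ℓ i j := by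
  induction ℓ generalizing j with
  | zero => exact h
  | succ ℓ ih =>
    obtain ⟨m, hm, hlt, ha⟩ := h
    have := hm.add_le
    exact ⟨m, ih hm fun u v h1 h2 h3 => hab u v h1 h2 (by omega), hlt,
      hab _ _ (by omega) hlt le_rfl ha⟩

/-- At most one edge of an increasing path jumps over `c`; it accounts for the `+ 1`. -/
theorem Conn.split {ℓ : ℕ} {i k : ℤ} (h : Conn a ℓ i k) {c : ℤ} (hic : i ≤ c) (hck : c ≤ k) :
    ∃ ℓ₁ ℓ₂ j₁ j₂, Conn a ℓ₁ i j₁ ∧ j₁ ≤ c ∧ c ≤ j₂ ∧ Conn a ℓ₂ j₂ k ∧ ℓ ≤ ℓ₁ + ℓ₂ + 1 := by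
  induction ℓ generalizing k with
  | zero => exact ⟨0, 0, i, k, rfl, hic, hck, rfl, by omega⟩
  | succ ℓ ih =>
    obtain ⟨m, hm, hlt, ha⟩ := h
    rcases le_or_gt c m with hcm | hcm
    · obtain ⟨ℓ₁, ℓ₂, j₁, j₂, h1, h2, h3, h4, h5⟩ := ih hm hcm
      exact ⟨ℓ₁, ℓ₂ + 1, j₁, j₂, h1, h2, h3, ⟨m, h4, hlt, ha⟩, by omega⟩
    · exact ⟨ℓ, 0, m, k, hm, hcm.le, hck, rfl, by omega⟩

theorem Conn.le_T {ℓ : ℕ} {i j : ℤ} (h : Conn a ℓ i j) : ℓ ≤ T a i j :=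
  le_csSup (bddAbove_pathLengths a i j) (mem_pathLengths_iff_conn.2 h)

theorem conn_T {i j : ℤ} (h : ∃ ℓ, Conn a ℓ i j) : Conn a (T a i j) i j :=
  mem_pathLengths_iff_conn.1 <| Nat.sSup_mem (h.imp fun _ => mem_pathLengths_iff_conn.2)
    (bddAbove_pathLengths a i j)

theorem T_eq_zero {i j : ℤ} (h : ¬ ∃ ℓ, Conn a ℓ i j) : T a i j = 0 := by
  have : pathLengths a i j = ∅ :=
    Set.eq_empty_of_forall_notMem fun ℓ hℓ => h ⟨ℓ, mem_pathLengths_iff_conn.1 hℓ⟩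
  simp [T, this]

theorem T_le_L {i i' j' j : ℤ} (h1 : i ≤ i') (h2 : i' ≤ j') (h3 : j' ≤ j) :
    T a i' j' ≤ L a i j :=
  (Finset.le_sup (f := fun j' => T a i' j') (Finset.mem_Icc.2 ⟨h2, h3⟩)).trans
    (Finset.le_sup (f := fun i' => (Finset.Icc i' j).sup fun j' => T a i' j')
      (Finset.mem_Icc.2 ⟨h1, h2.trans h3⟩))

theorem Conn.le_L {ℓ : ℕ} {i i' j' j : ℤ} (h : Conn a ℓ i' j') (h1 : i ≤ i') (h3 : j' ≤ j) :
    ℓ ≤ L a i j :=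
  h.le_T.trans (T_le_L h1 (by have := h.add_le; omega) h3)

theorem exists_conn_L {i j : ℤ} (hij : i ≤ j) :
    ∃ i' j', i ≤ i' ∧ i' ≤ j' ∧ j' ≤ j ∧ Conn a (L a i j) i' j' := by
  obtain ⟨i', hi', h⟩ := Finset.exists_mem_eq_sup (Finset.Icc i j) (Finset.nonempty_Icc.2 hij)
    (fun i' => (Finset.Icc i' j).sup fun j' => T a i' j')
  rw [Finset.mem_Icc] at hi'
  obtain ⟨j', hj', h'⟩ := Finset.exists_mem_eq_sup (Finset.Icc i' j)
    (Finset.nonempty_Icc.2 hi'.2) (fun j' => T a i' j')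
  rw [Finset.mem_Icc] at hj'
  have hL : L a i j = T a i' j' := h.trans h'
  by_cases hc : ∃ ℓ, Conn a ℓ i' j'
  · exact ⟨i', j', hi'.1, hj'.1, hj'.2, hL ▸ conn_T hc⟩
  -- Here the maximum is the default value 0, realised by the path reduced to the vertex `i`.
  · rw [hL, T_eq_zero hc]
    exact ⟨i, i, le_rfl, le_rfl, hij, rfl⟩

theorem L_le {i j : ℤ} (hij : i ≤ j) : (L a i j : ℤ) ≤ j - i := by
  obtain ⟨i', j', h1, h2, h3, h⟩ := exists_conn_L (a := a) hij
  have := h.add_le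
  omega

theorem L_le_add {i j k : ℤ} (hij : i ≤ j) (hjk : j ≤ k) :
    L a i k ≤ L a i j + L a j k + 1 := by
  obtain ⟨i', k', h1, h2, h3, h⟩ := exists_conn_L (a := a) (hij.trans hjk)
  rcases le_or_gt j i' with hj | hj
  · have := h.le_L hj h3
    omega
  rcases le_or_gt k' j with hk | hk
  · have := h.le_L h1 hk
    omega
  obtain ⟨ℓ₁, ℓ₂, j₁, j₂, g1, g2, g3, g4, g5⟩ := h.split hj.le hk.le
  have := g1.le_L h1 g2
  have := g4.le_L g3 h3
  omega

theorem L_mono_of_edges {i j : ℤ} (hij : i ≤ j)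
    (hab : ∀ u v, i ≤ u → u < v → v ≤ j → a u v = 1 → b u v = 1) : L a i j ≤ L b i j := by
  obtain ⟨i', j', h1, h2, h3, h⟩ := exists_conn_L (a := a) hij
  exact (h.congr fun u v g1 g2 g3 => hab u v (by omega) g2 (by omega)).le_L h1 h3

theorem L_congr {i j : ℤ} (hij : i ≤ j)
    (hab : ∀ u v, i ≤ u → u < v → v ≤ j → (a u v = 1 ↔ b u v = 1)) : L a i j = L b i j :=
  le_antisymm (L_mono_of_edges hij fun u v h1 h2 h3 => (hab u v h1 h2 h3).1)
    (L_mono_of_edges hij fun u v h1 h2 h3 => (hab u v h1 h2 h3).2)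

theorem T_congr {i j : ℤ}
    (hab : ∀ u v, i ≤ u → u < v → v ≤ j → (a u v = 1 ↔ b u v = 1)) : T a i j = T b i j := by
  have : pathLengths a i j = pathLengths b i j := by
    ext ℓ
    rw [mem_pathLengths_iff_conn, mem_pathLengths_iff_conn]
    exact ⟨fun h => h.congr fun u v h1 h2 h3 => (hab u v h1 h2 h3).1,
      fun h => h.congr fun u v h1 h2 h3 => (hab u v h1 h2 h3).2⟩
  rw [T, T, this]

theorem Conn.translate {ℓ : ℕ} {i j m : ℤ} (h : Conn a ℓ i j)
    (hab : ∀ u v, u < v → a u v = 1 → b (u + m) (v + m) = 1) : Conn b ℓ (i + m) (j + m) := by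
  induction ℓ generalizing j with
  | zero => exact congrArg (· + m) h
  | succ ℓ ih =>
    obtain ⟨k, hk, hlt, ha⟩ := h
    exact ⟨k + m, ih hk, by omega, hab _ _ hlt ha⟩

theorem L_translate_le {i j m : ℤ} (hij : i ≤ j)
    (hab : ∀ u v, u < v → a u v = 1 → b (u + m) (v + m) = 1) :
    L a i j ≤ L b (i + m) (j + m) := by
  obtain ⟨i', j', h1, h2, h3, h⟩ := exists_conn_L (a := a) hij
  exact (h.translate hab).le_L (by omega) (by omega)

/-! ### Good points -/

/-- The point `t` is good in `[i, j]` when every later point of `[i, j]` has an edge from a point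
in between or from `t`, and every earlier point has an edge to a point in between or to `t`. -/
def Good (a : ℤ → ℤ → EReal) (i j t : ℤ) : Prop :=
  (∀ v, t < v → v ≤ j → ∃ u, t ≤ u ∧ u < v ∧ a u v = 1) ∧
  (∀ u, i ≤ u → u < t → ∃ v, u < v ∧ v ≤ t ∧ a u v = 1)

theorem Good.mono {i i' j' j t : ℤ} (h : Good a i j t) (hi : i ≤ i') (hj : j' ≤ j) :
    Good a i' j' t :=
  ⟨fun v h1 h2 => h.1 v h1 (h2.trans hj), fun u h1 h2 => h.2 u (hi.trans h1) h2⟩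

theorem Good.congr {i j t : ℤ} (h : Good a i j t) (hit : i ≤ t) (htj : t ≤ j)
    (hab : ∀ u v, i ≤ u → u < v → v ≤ j → a u v = 1 → b u v = 1) : Good b i j t := by
  refine ⟨fun v h1 h2 => ?_, fun u h1 h2 => ?_⟩
  · obtain ⟨u, g1, g2, g3⟩ := h.1 v h1 h2
    exact ⟨u, g1, g2, hab u v (by omega) g2 h2 g3⟩
  · obtain ⟨v, g1, g2, g3⟩ := h.2 u h1 h2
    exact ⟨v, g1, g2, hab u v h1 g1 (by omega) g3⟩

theorem Good.translate {i j t m : ℤ} (h : Good a i j t)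
    (hab : ∀ u v, u < v → a u v = 1 → b (u + m) (v + m) = 1) :
    Good b (i + m) (j + m) (t + m) := by
  refine ⟨fun v h1 h2 => ?_, fun u h1 h2 => ?_⟩
  · obtain ⟨u, g1, g2, g3⟩ := h.1 (v - m) (by omega) (by omega)
    exact ⟨u + m, by omega, by omega, by simpa using hab u (v - m) g2 g3⟩
  · obtain ⟨v, g1, g2, g3⟩ := h.2 (u - m) (by omega) (by omega)
    exact ⟨v + m, by omega, by omega, by simpa using hab (u - m) v g1 g3⟩

/-- Each point after `t` has a predecessor no earlier than `t`; going backwards must end at `t`. -/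
theorem Good.exists_conn_from {i j t : ℤ} (h : Good a i j t) (n : ℕ) (hn : t + n ≤ j) :
    ∃ ℓ, Conn a ℓ t (t + n) := by
  induction n using Nat.strong_induction_on with
  | _ n ih =>
    rcases Nat.eq_zero_or_pos n with rfl | hpos
    · exact ⟨0, by simp [Conn]⟩
    obtain ⟨u, h1, h2, h3⟩ := h.1 (t + n) (by omega) hn
    obtain ⟨ℓ, hℓ⟩ := ih (u - t).toNat (by omega) (by omega)
    rw [show t + ((u - t).toNat : ℤ) = u by omega] at hℓ
    exact ⟨ℓ + 1, u, hℓ, h2, h3⟩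

theorem Good.exists_conn_to {i j t : ℤ} (h : Good a i j t) (n : ℕ) (hn : i ≤ t - n) :
    ∃ ℓ, Conn a ℓ (t - n) t := by
  induction n using Nat.strong_induction_on with
  | _ n ih =>
    rcases Nat.eq_zero_or_pos n with rfl | hpos
    · exact ⟨0, by simp [Conn]⟩
    obtain ⟨v, h1, h2, h3⟩ := h.2 (t - n) hn (by omega)
    obtain ⟨ℓ, hℓ⟩ := ih (t - v).toNat (by omega) (by omega)
    rw [show t - ((t - v).toNat : ℤ) = v by omega] at hℓ
    exact ⟨1 + ℓ, Conn.trans (j := v) ⟨t - n, rfl, h1, h3⟩ hℓ⟩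

theorem Good.conn_from {i j t v : ℤ} (h : Good a i j t) (h1 : t ≤ v) (h2 : v ≤ j) :
    ∃ ℓ, Conn a ℓ t v := by
  have := h.exists_conn_from (v - t).toNat (by omega)
  rwa [show t + ((v - t).toNat : ℤ) = v by omega] at this

theorem Good.conn_to {i j t u : ℤ} (h : Good a i j t) (h1 : i ≤ u) (h2 : u ≤ t) :
    ∃ ℓ, Conn a ℓ u t := by
  have := h.exists_conn_to (t - u).toNat (by omega)
  rwa [show t - ((t - u).toNat : ℤ) = u by omega] at this

theorem L_le_T_of_good {i j s t : ℤ} (hs : Good a i j s) (ht : Good a i j t) (his : i ≤ s)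
    (hst : s ≤ t) (htj : t ≤ j) : (L a i j : ℤ) ≤ T a i j + (s - i) + (j - t) + 2 := by
  have e1 := L_le_add (a := a) his (hst.trans htj)
  have e2 := L_le_add (a := a) hst htj
  have e3 := L_le (a := a) his
  have e4 := L_le (a := a) htj
  obtain ⟨x, y, h1, h2, h3, h⟩ := exists_conn_L (a := a) hst
  obtain ⟨ℓ₁, g1⟩ := hs.conn_to le_rfl his
  obtain ⟨ℓ₂, g2⟩ := hs.conn_from h1 (by omega)
  obtain ⟨ℓ₃, g3⟩ := ht.conn_to (u := y) (by omega) h3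
  obtain ⟨ℓ₄, g4⟩ := ht.conn_from htj le_rfl
  -- The route is `i → s → x → y → t → j`, where `x → y` is optimal in `[s,t]`.
  have := ((((g1.trans g2).trans h).trans g3).trans g4).le_T
  omega

open Classical in
/-- The number of good points in `[i, j]`. -/
noncomputable def numGood (a : ℤ → ℤ → EReal) (i j : ℤ) : ℕ :=
  ((Finset.Icc i j).filter (Good a i j)).card

/-- Goodness survives shrinking the interval, so each good point of `[i,k]` is counted on one side
or the other. -/
theorem numGood_le_add {i j k : ℤ} (hij : i ≤ j) (hjk : j ≤ k) :
    numGood a i k ≤ numGood a i j + numGood a j k := by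
  classical
  unfold numGood
  refine (Finset.card_le_card fun t ht => ?_).trans (Finset.card_union_le _ _)
  simp only [Finset.mem_union, Finset.mem_filter, Finset.mem_Icc] at ht ⊢
  rcases le_total t j with h | h
  · exact Or.inl ⟨⟨ht.1.1, h⟩, ht.2.mono le_rfl hjk⟩
  · exact Or.inr ⟨⟨h, ht.1.2⟩, ht.2.mono hij le_rfl⟩

theorem numGood_le {i j : ℤ} (hij : i ≤ j) : (numGood a i j : ℤ) ≤ j - i + 1 := by
  classical
  have : numGood a i j ≤ (Finset.Icc i j).card := Finset.card_filter_le _ _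
  rw [Int.card_Icc] at this
  omega

theorem numGood_congr {i j : ℤ}
    (hab : ∀ u v, i ≤ u → u < v → v ≤ j → (a u v = 1 ↔ b u v = 1)) :
    numGood a i j = numGood b i j := by
  classical
  unfold numGood
  congr 1
  refine Finset.filter_congr fun t ht => ?_
  rw [Finset.mem_Icc] at ht
  exact ⟨fun h => h.congr ht.1 ht.2 fun u v h1 h2 h3 => (hab u v h1 h2 h3).1,
    fun h => h.congr ht.1 ht.2 fun u v h1 h2 h3 => (hab u v h1 h2 h3).2⟩

theorem numGood_translate_le {i j m : ℤ}
    (hab : ∀ u v, u < v → a u v = 1 → b (u + m) (v + m) = 1) :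
    numGood a i j ≤ numGood b (i + m) (j + m) := by
  classical
  refine Finset.card_le_card_of_injOn (· + m) (fun t ht => ?_) (fun _ _ _ _ h => by simpa using h)
  simp only [Finset.coe_filter, Set.mem_ofPred_eq, Finset.mem_Icc, add_le_add_iff_right] at ht ⊢
  exact ⟨ht.1, ht.2.translate hab⟩

/-- Good points of `[i,k]` lying in `[j,k]` are good there too, so a strict excess must lie before
`j`. -/
theorem exists_good_lt {i j k : ℤ} (hij : i ≤ j) (h : numGood a j k < numGood a i k) :
    ∃ t, i ≤ t ∧ t < j ∧ t ≤ k ∧ Good a i k t := by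
  classical
  by_contra! hc
  refine h.not_ge (Finset.card_le_card fun t ht => ?_)
  simp only [Finset.mem_filter, Finset.mem_Icc] at ht ⊢
  refine ⟨⟨?_, ht.1.2⟩, ht.2.mono hij le_rfl⟩
  by_contra! htj
  exact hc t ht.1.1 htj ht.1.2 ht.2

theorem exists_good_gt {i j k : ℤ} (hjk : j ≤ k) (h : numGood a i j < numGood a i k) :
    ∃ t, i ≤ t ∧ j < t ∧ t ≤ k ∧ Good a i k t := by
  classical
  by_contra! hc
  refine h.not_ge (Finset.card_le_card fun t ht => ?_)
  simp only [Finset.mem_filter, Finset.mem_Icc] at ht ⊢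
  refine ⟨⟨ht.1.1, ?_⟩, ht.2.mono le_rfl hjk⟩
  by_contra! htj
  exact hc t ht.1.1 htj ht.1.2 ht.2

end LineModel

open scoped ENNReal

namespace LineModel

/-! ### Local functions of independent edges -/

/-- The pairs of integers that may carry an edge. -/
abbrev Edge : Type := {e : ℤ × ℤ // e.1 < e.2}

/-- The pairs inside `[i, j]`. -/
def edgesIn (i j : ℤ) : Set Edge := {e | i ≤ e.1.1 ∧ e.1.2 ≤ j}

theorem finite_edgesIn (i j : ℤ) : (edgesIn i j).Finite := by
  refine Set.Finite.of_finite_image (f := Subtype.val)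
    (((Set.finite_Icc i j).prod (Set.finite_Icc i j)).subset ?_) Subtype.val_injective.injOn
  rintro _ ⟨⟨⟨u, v⟩, he⟩, ⟨h1, h2⟩, rfl⟩
  dsimp only at he h1 h2
  exact ⟨⟨h1, (he.trans_le h2).le⟩, ⟨(h1.trans_lt he).le, h2⟩⟩

/-- Translation of configurations. -/
def translate (m : ℤ) (x : Edge → Bool) : Edge → Bool :=
  fun e => x ⟨(e.1.1 + m, e.1.2 + m), by simpa using e.2⟩

/-- Such a function factors through a finite discrete space, on which every map is measurable. -/
theorem measurable_of_dependsOn {β : Type*} [MeasurableSpace β] [Nonempty β]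
    {g : (Edge → Bool) → β} {S : Set Edge} (hS : S.Finite) (hg : DependsOn g S) :
    Measurable g := by
  obtain ⟨g', rfl⟩ := dependsOn_iff_exists_comp.1 hg
  have := hS.to_subtype
  exact (Measurable.of_discrete (f := g')).comp (by fun_prop)

theorem indepFun_of_dependsOn {β β' : Type*} [MeasurableSpace β] [Nonempty β]
    [MeasurableSpace β'] [Nonempty β'] {μ : Measure (Edge → Bool)}
    (hind : iIndepFun (fun (e : Edge) (x : Edge → Bool) => x e) μ)
    {g : (Edge → Bool) → β} {g' : (Edge → Bool) → β'} {S S' : Set Edge} (hS : S.Finite)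
    (hS' : S'.Finite) (hg : DependsOn g S) (hg' : DependsOn g' S') (hd : Disjoint S S') :
    IndepFun g g' μ := by
  obtain ⟨k, rfl⟩ := dependsOn_iff_exists_comp.1 hg
  obtain ⟨k', rfl⟩ := dependsOn_iff_exists_comp.1 hg'
  lift S to Finset Edge using hS
  lift S' to Finset Edge using hS'
  exact (hind.indepFun_finset S S' (by exact_mod_cast hd) (by fun_prop)).comp
    (Measurable.of_discrete (f := k)) (Measurable.of_discrete (f := k'))

/-- Subadditive processes over the intervals of `ℤ` that are local and translation covariant. -/
structure LocalSubadditive (f : ℤ → ℤ → (Edge → Bool) → ℕ) : Prop where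
  le_add : ∀ {i j k : ℤ} (x), i ≤ j → j ≤ k → f i k x ≤ f i j x + f j k x
  le : ∀ {i j : ℤ} (x), i ≤ j → (f i j x : ℤ) ≤ j - i + 1
  dependsOn : ∀ {i j : ℤ}, i ≤ j → DependsOn (f i j) (edgesIn i j)
  translate : ∀ {i j : ℤ} (m : ℤ) (x), i ≤ j → f i j (translate m x) = f (i + m) (j + m) x

/-! ### Time constant and upper bound for local subadditive processes -/

variable {f : ℤ → ℤ → (Edge → Bool) → ℕ} {μ : Measure (Edge → Bool)}

/-- The time constant `inf_n E f(0,n) / n`. -/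
noncomputable def rate (f : ℤ → ℤ → (Edge → Bool) → ℕ) (μ : Measure (Edge → Bool)) : ℝ :=
  ⨅ n : ℕ, (∫ x, (f 0 (n + 1) x : ℝ) ∂μ) / (n + 1)

theorem bddBelow_rate : BddBelow (Set.range fun n : ℕ =>
    (∫ x, (f 0 (n + 1) x : ℝ) ∂μ) / (n + 1)) := by
  refine ⟨0, ?_⟩
  rintro _ ⟨n, rfl⟩
  have : 0 ≤ ∫ x, (f 0 (n + 1) x : ℝ) ∂μ := integral_nonneg fun x => Nat.cast_nonneg _
  positivity

theorem rate_nonneg : 0 ≤ rate f μ := by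
  refine le_ciInf fun n => ?_
  have : 0 ≤ ∫ x, (f 0 (n + 1) x : ℝ) ∂μ := integral_nonneg fun x => Nat.cast_nonneg _
  positivity

theorem rate_mul_le (n : ℕ) : rate f μ * n ≤ ∫ x, (f 0 n x : ℝ) ∂μ := by
  rcases n with _ | n
  · simpa using integral_nonneg fun x => Nat.cast_nonneg _
  · have h := ciInf_le (bddBelow_rate (f := f) (μ := μ)) n
    rw [← rate, le_div_iff₀ (by positivity)] at h
    exact_mod_cast h

namespace LocalSubadditive

theorem measurable (hf : LocalSubadditive f) {i j : ℤ} (hij : i ≤ j) : Measurable (f i j) :=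
  measurable_of_dependsOn (finite_edgesIn i j) (hf.dependsOn hij)

theorem cast_le (hf : LocalSubadditive f) {i j : ℤ} (x) (hij : i ≤ j) :
    (f i j x : ℝ) ≤ j - i + 1 := by
  exact_mod_cast hf.le x hij

theorem integrable [IsProbabilityMeasure μ] (hf : LocalSubadditive f) {i j : ℤ} (hij : i ≤ j) :
    Integrable (fun x => (f i j x : ℝ)) μ := by
  refine Integrable.of_bound (C := j - i + 1)
    ((measurable_from_nat (f := fun n : ℕ => (n : ℝ))).comp (hf.measurable hij)).aestronglyMeasurable
    (ae_of_all _ fun x => ?_)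
  rw [Real.norm_of_nonneg (Nat.cast_nonneg _)]
  exact hf.cast_le x hij

/-- The strong law of large numbers along the blocks of length `m`. -/
theorem strong_law_blocks [IsProbabilityMeasure μ] (hf : LocalSubadditive f)
    (hind : iIndepFun (fun (e : Edge) (x : Edge → Bool) => x e) μ)
    (hμ : ∀ m, MeasurePreserving (LineModel.translate m) μ μ) (m : ℕ) :
    ∀ᵐ x ∂μ, Tendsto (fun n : ℕ =>
      (∑ k ∈ Finset.range n, (f (m * k : ℕ) (m * k + m : ℕ) x : ℝ)) / n) atTop
      (𝓝 (∫ x, (f 0 m x : ℝ) ∂μ)) := by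
  have hle : ∀ k : ℕ, ((m * k : ℕ) : ℤ) ≤ (m * k + m : ℕ) := fun k => by push_cast; omega
  have hcast : Measurable (fun n : ℕ => (n : ℝ)) := measurable_from_nat
  have := strong_law_ae_real (μ := μ)
    (fun (k : ℕ) x => (f (m * k : ℕ) (m * k + m : ℕ) x : ℝ)) (hf.integrable (hle 0)) ?_ ?_
  · simpa using this
  · intro k l hkl
    refine (indepFun_of_dependsOn hind (finite_edgesIn _ _) (finite_edgesIn _ _)
      (hf.dependsOn (hle k)) (hf.dependsOn (hle l)) ?_).comp hcast hcast
    -- Adjacent blocks share a vertex but no edge.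
    rw [Set.disjoint_left]
    rintro ⟨⟨u, v⟩, huv⟩ ⟨h1, h2⟩ ⟨h3, h4⟩
    dsimp only at huv h1 h2 h3 h4
    rcases lt_or_gt_of_ne hkl with h | h
    · have : m * k + m ≤ m * l := by nlinarith
      omega
    · have : m * l + m ≤ m * k := by nlinarith
      omega
  · intro k
    have h0 : Measurable (f ((m * 0 : ℕ) : ℤ) (m * 0 + m : ℕ)) := hf.measurable (hle 0)
    refine IdentDistrib.comp (u := fun n : ℕ => (n : ℝ))
      ⟨(hf.measurable (hle k)).aemeasurable, h0.aemeasurable, ?_⟩ hcast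
    have : f ((m * k : ℕ) : ℤ) (m * k + m : ℕ) =
        f ((m * 0 : ℕ) : ℤ) (m * 0 + m : ℕ) ∘ LineModel.translate (m * k) := by
      ext x
      rw [Function.comp_apply, hf.translate _ _ (hle 0)]
      congr 1 <;> push_cast <;> ring
    rw [this, ← Measure.map_map h0 (hμ _).measurable, (hμ _).map_eq]

/-- The `+ 1` covers `d = 0`, where the process on a single point may equal 1. -/
theorem le_sum_blocks (hf : LocalSubadditive f) (m k d : ℕ) (x) :
    f (m * k : ℕ) (m * (k + d) : ℕ) x ≤
      ∑ l ∈ Finset.Ico k (k + d), f (m * l : ℕ) (m * l + m : ℕ) x + 1 := by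
  induction d with
  | zero =>
    have := hf.le (i := (m * k : ℕ)) (j := (m * k : ℕ)) x le_rfl
    simp only [add_zero, Finset.Ico_self, Finset.sum_empty, zero_add]
    omega
  | succ d ih =>
    have := hf.le_add (i := (m * k : ℕ)) (j := (m * (k + d) : ℕ)) (k := (m * (k + d) + m : ℕ)) x
      (by push_cast; nlinarith) (by push_cast; omega)
    rw [← add_assoc, Finset.sum_Ico_succ_top (by omega), mul_add m (k + d) 1, mul_one]
    omega

/-- The process grows at most at the given rate, uniformly over the intervals inside `[0, n]`. -/
theorem eventually_le [IsProbabilityMeasure μ] (hf : LocalSubadditive f)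
    (hind : iIndepFun (fun (e : Edge) (x : Edge → Bool) => x e) μ)
    (hμ : ∀ m, MeasurePreserving (LineModel.translate m) μ μ) {δ : ℝ} (hδ : 0 < δ) :
    ∀ᵐ x ∂μ, ∀ᶠ n : ℕ in atTop, ∀ i j : ℕ, i ≤ j → j ≤ n →
      (f i j x : ℝ) ≤ rate f μ * (j - i) + δ * n := by
  obtain ⟨m', hm'⟩ : ∃ m' : ℕ, (∫ x, (f 0 (m' + 1) x : ℝ) ∂μ) / (m' + 1) < rate f μ + δ / 4 :=
    exists_lt_of_ciInf_lt (lt_add_of_pos_right _ (by positivity))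
  set m : ℕ := m' + 1 with hm
  have hm0 : (0 : ℝ) < m := by positivity
  set M : ℝ := ∫ x, (f 0 m x : ℝ) ∂μ with hM
  have hMle : M ≤ (rate f μ + δ / 4) * m := by
    rw [div_lt_iff₀ (by positivity)] at hm'
    simpa [hM, hm] using hm'.le
  have hM0 : 0 ≤ M := integral_nonneg fun x => Nat.cast_nonneg _
  filter_upwards [hf.strong_law_blocks hind hμ m] with x hx
  set S : ℕ → ℝ := fun n => ∑ k ∈ Finset.range n, (f (m * k : ℕ) (m * k + m : ℕ) x : ℝ) with hS
  obtain ⟨n₀, hn₀⟩ : ∃ n₀ : ℕ, ∀ n ≥ n₀, |S n - M * n| ≤ δ / 8 * n := by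
    have := (Metric.tendsto_atTop.1 hx) (δ / 8) (by positivity)
    obtain ⟨n₀, h⟩ := this
    refine ⟨n₀ + 1, fun n hn => ?_⟩
    have h1 := (h n (by omega)).le
    have hn0 : (0 : ℝ) < n := by exact_mod_cast (by omega : 0 < n)
    rw [Real.dist_eq, div_sub' hn0.ne', abs_div, abs_of_pos hn0, div_le_iff₀ hn0] at h1
    rwa [mul_comm M]
  -- The finitely many early deviations are absorbed in `R`. The bound then holds at every index,
  -- which makes differences `S (k + d) - S k` controllable uniformly in the starting block.
  obtain ⟨R, hR0, hR⟩ : ∃ R : ℝ, 0 ≤ R ∧ ∀ n, |S n - M * n| ≤ δ / 8 * n + R := by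
    refine ⟨∑ n ∈ Finset.range n₀, |S n - M * n|, by positivity, fun n => ?_⟩
    rcases le_or_gt n₀ n with h | h
    · exact (hn₀ n h).trans (le_add_of_nonneg_right (by positivity))
    · refine (Finset.single_le_sum (f := fun n : ℕ => |S n - M * n|)
        (fun _ _ => abs_nonneg _) (Finset.mem_range.2 h)).trans
        (le_add_of_nonneg_left (by positivity))
  -- The constant collects the two incomplete end blocks, the `+ 1` of `le_sum_blocks` and twice
  -- `R`; it takes half of `δ * n`. The choice of `m` takes a quarter, and the deviations of the two
  -- partial sums an eighth each.
  obtain ⟨n₁, hn₁⟩ := exists_nat_ge ((2 * (m + 1) + 1 + 2 * R) / (δ / 2))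
  filter_upwards [eventually_ge_atTop n₁] with n hn i j hij hjn
  have hnR : 2 * ((m : ℝ) + 1) + 1 + 2 * R ≤ δ / 2 * n := by
    rw [div_le_iff₀ (by positivity)] at hn₁
    have : (n₁ : ℝ) ≤ n := by exact_mod_cast hn
    nlinarith
  have hγ : 0 ≤ rate f μ := rate_nonneg
  have hijR : (i : ℝ) ≤ j := by exact_mod_cast hij
  have hjnR : (j : ℝ) ≤ n := by exact_mod_cast hjn
  rcases le_or_gt (j - i) m with hsmall | hbig
  · have h1 := hf.cast_le (i := i) (j := j) x (by exact_mod_cast hij)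
    have h2 : (j : ℝ) ≤ i + m := by exact_mod_cast (by omega : j ≤ i + m)
    push_cast at h1
    nlinarith [mul_nonneg hγ (sub_nonneg.2 hijR)]
  obtain ⟨k, hk1, hk2⟩ : ∃ k, i ≤ m * k ∧ m * k ≤ i + m :=
    ⟨i / m + 1, (Nat.lt_mul_div_succ i (by omega)).le, by
      have := Nat.mul_div_le i m
      rw [mul_add]
      omega⟩
  obtain ⟨l, hl1, hl2⟩ : ∃ l, m * l ≤ j ∧ j ≤ m * l + m :=
    ⟨j / m, Nat.mul_div_le j m, (Nat.lt_mul_div_succ j (by omega)).le⟩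
  have hkl : k ≤ l := by
    by_contra! h
    have : m * l + m ≤ m * k := by nlinarith
    omega
  obtain ⟨d, rfl⟩ := Nat.exists_eq_add_of_le hkl
  have hkd : m * k ≤ m * (k + d) := Nat.mul_le_mul_left m hkl
  have e1 := hf.le_add (i := i) (j := (m * k : ℕ)) (k := j) x (by omega) (by omega)
  have e2 := hf.le_add (i := (m * k : ℕ)) (j := (m * (k + d) : ℕ)) (k := j) x (by omega) (by omega)
  have e3 := hf.le_sum_blocks m k d x
  have e4 := hf.le (i := i) (j := (m * k : ℕ)) x (by omega)
  have e5 := hf.le (i := (m * (k + d) : ℕ)) (j := j) x (by omega)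
  have e6 : f i j x ≤ ∑ l ∈ Finset.Ico k (k + d), f (m * l : ℕ) (m * l + m : ℕ) x
      + 2 * (m + 1) + 1 := by omega
  have e7 : (f i j x : ℝ) ≤ S (k + d) - S k + 2 * (m + 1) + 1 := by
    rw [hS, ← Finset.sum_Ico_eq_sub _ hkl]
    exact_mod_cast e6
  have e8 := (abs_le.1 (hR (k + d))).2
  have e9 := (abs_le.1 (hR k)).1
  have e10 : (m : ℝ) * (k + d) ≤ j := by exact_mod_cast hl1
  have e11 : (i : ℝ) ≤ m * k := by exact_mod_cast hk1
  have e12 : (1 : ℝ) ≤ m := by exact_mod_cast (by omega : 1 ≤ m)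
  have hd0 : (0 : ℝ) ≤ d := by positivity
  have hk0 : (0 : ℝ) ≤ k := by positivity
  have e13 : M * d ≤ rate f μ * (j - i) + δ / 4 * n := by
    calc M * d ≤ (rate f μ + δ / 4) * m * d := by gcongr
      _ = (rate f μ + δ / 4) * (m * d) := by ring
      _ ≤ (rate f μ + δ / 4) * (j - i) := by
          gcongr
          linarith
      _ ≤ _ := by
          have : (j : ℝ) - i ≤ n := by
            have : (0 : ℝ) ≤ i := by positivity
            linarith
          nlinarith
  have e14 : (k : ℝ) + d ≤ n := by nlinarith
  push_cast at e8
  nlinarith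

end LocalSubadditive

end LineModel

open scoped ENNReal NNReal

namespace LineModel

/-! ### The lower rate -/

theorem le_of_forall_mul_natCast_le_add {a c d : ℝ≥0∞} (hd : d ≠ ∞)
    (h : ∀ n : ℕ, a * n ≤ c * n + d) : a ≤ c := by
  refine ENNReal.le_of_forall_pos_le_add fun ε hε _ => ?_
  lift d to ℝ≥0 using hd
  obtain ⟨n, hn⟩ := exists_nat_ge (d / ε)
  have h0 : ((n + 1 : ℕ) : ℝ≥0∞) ≠ 0 := by positivity
  refine (ENNReal.mul_le_mul_iff_left h0 (ENNReal.natCast_ne_top _)).1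
    ((h (n + 1)).trans ?_)
  rw [add_mul]
  gcongr
  have : d ≤ ε * (n + 1 : ℕ) := by
    rw [div_le_iff₀ hε] at hn
    push_cast
    calc d ≤ n * ε := hn
      _ = ε * n := mul_comm _ _
      _ ≤ ε * (n + 1) := by gcongr; simp
  exact_mod_cast this

/-- From a point outside `B`, jump by a `k` with cost at most `c * k`; from a point of `B`, step by
one at cost at most 2. Once at most `N` remains, the crude bound `N + 1` finishes. -/
theorem greedy_cover (F : ℕ → ℕ → ℕ) (hadd : ∀ i j k, i ≤ j → j ≤ k → F i k ≤ F i j + F j k)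
    (hle : ∀ i d, F i (i + d) ≤ d + 1) (c : ℝ≥0∞) (N : ℕ) (B : Set ℕ)
    (hB : ∀ i ∉ B, ∃ k, 1 ≤ k ∧ k ≤ N ∧ (F i (i + k) : ℝ≥0∞) ≤ c * k) (d i : ℕ) :
    (F i (i + d) : ℝ≥0∞) ≤
      c * d + 2 * ∑ j ∈ Finset.Ico i (i + d), B.indicator 1 j + (N + 1) := by
  induction d using Nat.strong_induction_on generalizing i with
  | _ d ih =>
    rcases le_or_gt d N with hd | hd
    · calc (F i (i + d) : ℝ≥0∞) ≤ (N + 1 : ℕ) := by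
            exact_mod_cast (hle i d).trans (by omega)
        _ ≤ _ := by push_cast; exact le_add_self
    by_cases hi : i ∈ B
    · obtain ⟨d, rfl⟩ : ∃ d', d = d' + 1 := ⟨d - 1, by omega⟩
      have h1 := hadd i (i + 1) (i + (d + 1)) (by omega) (by omega)
      have h2 := hle i 1
      have h3 := ih d (by omega) (i + 1)
      rw [show i + 1 + d = i + (d + 1) by omega] at h3
      rw [Finset.sum_eq_sum_Ico_succ_bot (by omega), Set.indicator_of_mem hi, Pi.one_apply]
      calc (F i (i + (d + 1)) : ℝ≥0∞) ≤ (2 + F (i + 1) (i + (d + 1)) : ℕ) := by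
            exact_mod_cast (by omega)
        _ ≤ 2 + (c * d + 2 * ∑ j ∈ Finset.Ico (i + 1) (i + (d + 1)), B.indicator 1 j + (N + 1)) := by
            push_cast
            gcongr
        _ = c * d + 2 * (1 + ∑ j ∈ Finset.Ico (i + 1) (i + (d + 1)), B.indicator 1 j) + (N + 1) := by
            ring
        _ ≤ _ := by
            gcongr
            omega
    · obtain ⟨k, hk1, hkN, hk⟩ := hB i hi
      obtain ⟨d, rfl⟩ : ∃ d', d = k + d' := ⟨d - k, by omega⟩
      have h1 := hadd i (i + k) (i + (k + d)) (by omega) (by omega)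
      have h3 := ih d (by omega) (i + k)
      rw [add_assoc] at h3
      calc (F i (i + (k + d)) : ℝ≥0∞) ≤ (F i (i + k) + F (i + k) (i + (k + d)) : ℕ) := by
            exact_mod_cast h1
        _ ≤ c * k + (c * d + 2 * ∑ j ∈ Finset.Ico (i + k) (i + (k + d)), B.indicator 1 j + (N + 1)) := by
            push_cast
            gcongr
        _ = c * (k + d : ℕ) + 2 * ∑ j ∈ Finset.Ico (i + k) (i + (k + d)), B.indicator 1 j + (N + 1) := by
            push_cast
            ring
        _ ≤ _ := by
            gcongr
            omega

/-- The lower growth rate of the process to the right of `i`. -/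
noncomputable def lowerRate (f : ℤ → ℤ → (Edge → Bool) → ℕ) (i : ℕ) (x : Edge → Bool) : ℝ≥0∞ :=
  liminf (fun n : ℕ => (f i (i + n : ℕ) x : ℝ≥0∞) / n) atTop

/-- The process does not come down to its lower rate, up to `ε`, within `N` steps from `i`. -/
def slowSet (f : ℤ → ℤ → (Edge → Bool) → ℕ) (ε : ℝ≥0∞) (N i : ℕ) : Set (Edge → Bool) :=
  {x | ∀ k : ℕ, 1 ≤ k → k ≤ N → (lowerRate f i x + ε) * k < f i (i + k : ℕ) x}

variable {f : ℤ → ℤ → (Edge → Bool) → ℕ} {μ : Measure (Edge → Bool)}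

namespace LocalSubadditive

theorem measurable_coe (hf : LocalSubadditive f) {i j : ℤ} (hij : i ≤ j) :
    Measurable (fun x => (f i j x : ℝ≥0∞)) :=
  (measurable_from_nat (f := fun n : ℕ => (n : ℝ≥0∞))).comp (hf.measurable hij)

theorem measurable_lowerRate (hf : LocalSubadditive f) (i : ℕ) : Measurable (lowerRate f i) :=
  .liminf fun n => (hf.measurable_coe (by push_cast; omega)).div_const _

theorem lowerRate_eq (hf : LocalSubadditive f) (i : ℕ) (x) :
    lowerRate f i x = lowerRate f 0 (LineModel.translate i x) := by
  unfold lowerRate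
  congr with n
  rw [hf.translate _ _ (by push_cast; omega)]
  congr 3 <;> push_cast <;> ring

theorem lowerRate_le_two (hf : LocalSubadditive f) (i : ℕ) (x) : lowerRate f i x ≤ 2 := by
  refine (liminf_le_limsup).trans (limsup_le_of_le (by isBoundedDefault) ?_)
  filter_upwards [eventually_ge_atTop 1] with n hn
  have h0 : (n : ℝ≥0∞) ≠ 0 := by simp; omega
  rw [ENNReal.div_le_iff h0 (ENNReal.natCast_ne_top _)]
  have := hf.le (i := i) (j := (i + n : ℕ)) x (by push_cast; omega)
  have h : f i (i + n : ℕ) x ≤ 2 * n := by push_cast at this ⊢; omega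
  exact_mod_cast h

/-- The first `i` steps add at most `i + 1`, which vanishes after division by `n`. -/
theorem lowerRate_zero_le (hf : LocalSubadditive f) (i : ℕ) (x) :
    lowerRate f 0 x ≤ lowerRate f i x := by
  refine ENNReal.le_of_forall_pos_le_add fun ε hε _ => ?_
  rw [lowerRate, ← liminf_nat_add _ i, lowerRate,
    ← liminf_add_const _ _ _ (by isBoundedDefault) (by isBoundedDefault)]
  refine liminf_le_liminf ?_
  obtain ⟨n₀, hn₀⟩ := exists_nat_ge ((i + 1) / ε)
  filter_upwards [eventually_ge_atTop (n₀ + 1)] with n hn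
  have h0 : (n : ℝ≥0∞) ≠ 0 := by simp; omega
  have h1 : ((n + i : ℕ) : ℝ≥0∞) ≠ 0 := by simp; omega
  have hadd := hf.le_add (i := (0 : ℕ)) (j := i) (k := (i + n : ℕ)) x (by simp) (by simp)
  have hle := hf.le (i := (0 : ℕ)) (j := i) x (by simp)
  rw [Nat.cast_zero] at hadd hle
  have hi : ((i + 1 : ℕ) : ℝ≥0∞) ≤ ε * n := by
    have : ((i + 1 : ℕ) : ℝ≥0) ≤ ε * n := by
      rw [div_le_iff₀ hε] at hn₀
      push_cast
      calc (i + 1 : ℝ≥0) ≤ n₀ * ε := hn₀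
        _ = ε * n₀ := mul_comm _ _
        _ ≤ ε * n := by gcongr; omega
    exact_mod_cast this
  rw [zero_add, add_comm n i]
  calc (f (0 : ℕ) (i + n : ℕ) x : ℝ≥0∞) / (i + n : ℕ)
      ≤ ((i + 1 : ℕ) + f i (i + n : ℕ) x) / (i + n : ℕ) := by
        gcongr
        exact_mod_cast (by omega)
    _ ≤ ((i + 1 : ℕ) + f i (i + n : ℕ) x) / n := by
        gcongr
        omega
    _ ≤ (ε * n + f i (i + n : ℕ) x) / n := by gcongr
    _ = _ := by
        rw [ENNReal.add_div, ENNReal.mul_div_cancel_right h0 (ENNReal.natCast_ne_top _), add_comm]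

theorem lintegral_lowerRate (hf : LocalSubadditive f)
    (hμ : ∀ m, MeasurePreserving (LineModel.translate m) μ μ) (i : ℕ) :
    ∫⁻ x, lowerRate f i x ∂μ = ∫⁻ x, lowerRate f 0 x ∂μ := by
  simp_rw [hf.lowerRate_eq i]
  exact (hμ i).lintegral_comp (hf.measurable_lowerRate 0)

theorem lintegral_lowerRate_le_two [IsProbabilityMeasure μ] (hf : LocalSubadditive f) (i : ℕ) :
    ∫⁻ x, lowerRate f i x ∂μ ≤ 2 :=
  (lintegral_mono (hf.lowerRate_le_two i)).trans (by simp)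

/-- A pointwise inequality between functions with the same finite integral is almost everywhere an
equality. Thus one rate serves all starting points in the greedy covering. -/
theorem lowerRate_ae_eq [IsProbabilityMeasure μ] (hf : LocalSubadditive f)
    (hμ : ∀ m, MeasurePreserving (LineModel.translate m) μ μ) (i : ℕ) :
    lowerRate f 0 =ᵐ[μ] lowerRate f i :=
  ae_eq_of_ae_le_of_lintegral_le (ae_of_all _ (hf.lowerRate_zero_le i))
    ((hf.lintegral_lowerRate_le_two 0).trans_lt (by simp)).ne
    (hf.measurable_lowerRate i).aemeasurable (hf.lintegral_lowerRate hμ i).le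

theorem measurableSet_slowSet (hf : LocalSubadditive f) (ε : ℝ≥0∞) (N i : ℕ) :
    MeasurableSet (slowSet f ε N i) := by
  have : slowSet f ε N i = ⋂ k : ℕ, ⋂ _ : 1 ≤ k, ⋂ _ : k ≤ N,
      {x | (lowerRate f i x + ε) * k < f i (i + k : ℕ) x} := by
    ext x
    simp [slowSet]
  rw [this]
  exact .iInter fun k => .iInter fun _ => .iInter fun _ =>
    measurableSet_lt (((hf.measurable_lowerRate i).add_const _).mul_const _)
      (hf.measurable_coe (by push_cast; omega))

theorem measure_slowSet (hf : LocalSubadditive f)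
    (hμ : ∀ m, MeasurePreserving (LineModel.translate m) μ μ) (ε : ℝ≥0∞) (N i : ℕ) :
    μ (slowSet f ε N i) = μ (slowSet f ε N 0) := by
  rw [← (hμ i).measure_preimage (hf.measurableSet_slowSet ε N 0).nullMeasurableSet]
  congr 1
  ext x
  simp only [slowSet, Set.mem_preimage, Set.mem_ofPred_eq, ← hf.lowerRate_eq]
  refine forall₃_congr fun k _ _ => ?_
  rw [hf.translate _ _ (by push_cast; omega)]
  have e1 : ((0 : ℕ) : ℤ) + i = i := by simp
  have e2 : ((0 + k : ℕ) : ℤ) + i = (i + k : ℕ) := by push_cast; ring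
  rw [e1, e2]

theorem tendsto_measure_slowSet [IsProbabilityMeasure μ] (hf : LocalSubadditive f) {ε : ℝ≥0∞}
    (hε : 0 < ε) : Tendsto (fun N => μ (slowSet f ε N 0)) atTop (𝓝 0) := by
  have h := tendsto_measure_iInter_atTop (μ := μ) (s := fun N => slowSet f ε N 0)
    (fun N => (hf.measurableSet_slowSet ε N 0).nullMeasurableSet)
    (fun N N' hN x hx k h1 h2 => hx k h1 (h2.trans hN)) ⟨0, measure_ne_top _ _⟩
  -- A point in every slow set would keep `f / n` above its lower limit plus `ε` for all `n ≥ 1`.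
  suffices h' : ⋂ N, slowSet f ε N 0 = ∅ by rwa [h', measure_empty] at h
  refine Set.eq_empty_of_forall_notMem fun x hx => ?_
  have hlt : lowerRate f 0 x < lowerRate f 0 x + ε :=
    ENNReal.lt_add_right ((hf.lowerRate_le_two 0 x).trans_lt (by simp)).ne hε.ne'
  obtain ⟨n, hn, hn1⟩ := ((frequently_lt_of_liminf_lt (by isBoundedDefault) hlt).and_eventually
    (eventually_ge_atTop 1)).exists
  have h0 : (n : ℝ≥0∞) ≠ 0 := by simp; omega
  rw [ENNReal.div_lt_iff (Or.inl h0) (Or.inl (ENNReal.natCast_ne_top _))] at hn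
  exact (Set.mem_iInter.1 hx n n hn1 le_rfl).not_gt hn

theorem lintegral_le [IsProbabilityMeasure μ] (hf : LocalSubadditive f)
    (hμ : ∀ m, MeasurePreserving (LineModel.translate m) μ μ) (ε : ℝ≥0∞) (N n : ℕ) :
    ∫⁻ x, f 0 n x ∂μ ≤
      (∫⁻ x, lowerRate f 0 x ∂μ + ε + 2 * μ (slowSet f ε N 0)) * n + (N + 1) := by
  have key : ∀ᵐ x ∂μ, (f 0 n x : ℝ≥0∞) ≤ (lowerRate f 0 x + ε) * n +
      2 * ∑ j ∈ Finset.range n, (slowSet f ε N j).indicator 1 x + (N + 1) := by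
    filter_upwards [ae_all_iff.2 (hf.lowerRate_ae_eq hμ)] with x hx
    have := greedy_cover (fun i j => f i j x)
      (fun i j k h1 h2 => hf.le_add x (by exact_mod_cast h1) (by exact_mod_cast h2))
      (fun i d => by
        have := hf.le (i := i) (j := (i + d : ℕ)) x (by push_cast; omega)
        push_cast at this ⊢
        omega)
      (lowerRate f 0 x + ε) N {i | x ∈ slowSet f ε N i} (fun i hi => by
        simp only [slowSet, Set.mem_ofPred_eq, not_forall, not_lt] at hi
        obtain ⟨k, h1, h2, h3⟩ := hi
        exact ⟨k, h1, h2, by rwa [hx i]⟩) n 0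
    simp only [zero_add, Nat.Ico_zero_eq_range] at this
    exact this
  refine (lintegral_mono_ae key).trans (le_of_eq ?_)
  have hm : ∀ j, Measurable fun x => (slowSet f ε N j).indicator (1 : (Edge → Bool) → ℝ≥0∞) x :=
    fun j => measurable_one.indicator (hf.measurableSet_slowSet ε N j)
  have hh := hf.measurable_lowerRate 0
  rw [lintegral_add_right _ measurable_const, lintegral_add_left (by fun_prop),
    lintegral_mul_const _ (by fun_prop), lintegral_add_right _ measurable_const,
    lintegral_const_mul _ (by fun_prop), lintegral_finsetSum _ fun j _ => hm j]
  simp only [lintegral_indicator_one (hf.measurableSet_slowSet ε N _), hf.measure_slowSet hμ,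
    lintegral_const, measure_univ, mul_one, Finset.sum_const, Finset.card_range, nsmul_eq_mul]
  ring

/-- In `lintegral_le`, divide by `n`, then let `N` tend to infinity and `ε` to 0. -/
theorem rate_le_lintegral [IsProbabilityMeasure μ] (hf : LocalSubadditive f)
    (hμ : ∀ m, MeasurePreserving (LineModel.translate m) μ μ) :
    ENNReal.ofReal (rate f μ) ≤ ∫⁻ x, lowerRate f 0 x ∂μ := by
  refine ENNReal.le_of_forall_pos_le_add fun ε hε _ => ?_
  have hN : ∀ N : ℕ, ENNReal.ofReal (rate f μ) ≤
      ∫⁻ x, lowerRate f 0 x ∂μ + ε + 2 * μ (slowSet f ε N 0) := fun N => by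
    refine le_of_forall_mul_natCast_le_add (d := N + 1) (by finiteness) fun n => ?_
    refine le_trans ?_ (hf.lintegral_le hμ ε N n)
    rw [← ENNReal.ofReal_natCast n, ← ENNReal.ofReal_mul rate_nonneg]
    refine (ENNReal.ofReal_le_ofReal (rate_mul_le n)).trans (le_of_eq ?_)
    rw [ofReal_integral_eq_lintegral_ofReal (hf.integrable (by simp))
      (ae_of_all _ fun x => Nat.cast_nonneg _)]
    simp
  have hε' : (0 : ℝ≥0∞) < ε := by exact_mod_cast hε
  have hlim := (ENNReal.Tendsto.const_mul (a := 2) (hf.tendsto_measure_slowSet (μ := μ) hε')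
    (Or.inr (by simp))).const_add (∫⁻ x, lowerRate f 0 x ∂μ + ε)
  rw [mul_zero, add_zero] at hlim
  exact ge_of_tendsto' hlim hN

/-- The subadditive ergodic theorem for local processes of independent edges. -/
theorem tendsto_div [IsProbabilityMeasure μ] (hf : LocalSubadditive f)
    (hind : iIndepFun (fun (e : Edge) (x : Edge → Bool) => x e) μ)
    (hμ : ∀ m, MeasurePreserving (LineModel.translate m) μ μ) :
    ∀ᵐ x ∂μ, Tendsto (fun n : ℕ => (f 0 n x : ℝ) / n) atTop (𝓝 (rate f μ)) := by
  have hsup : ∀ᵐ x ∂μ, limsup (fun n : ℕ => (f 0 n x : ℝ≥0∞) / n) atTop ≤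
      ENNReal.ofReal (rate f μ) := by
    filter_upwards [ae_all_iff.2 fun k : ℕ =>
      hf.eventually_le hind hμ (δ := 1 / (k + 1)) (by positivity)] with x hx
    have hk : ∀ k : ℕ, limsup (fun n : ℕ => (f 0 n x : ℝ≥0∞) / n) atTop ≤
        ENNReal.ofReal (rate f μ + 1 / (k + 1)) := fun k => by
      refine limsup_le_of_le (by isBoundedDefault) ?_
      filter_upwards [hx k, eventually_ge_atTop 1] with n hn hn1
      have h0 : (n : ℝ≥0∞) ≠ 0 := by simp; omega
      rw [ENNReal.div_le_iff h0 (ENNReal.natCast_ne_top _), ← ENNReal.ofReal_natCast n,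
        ← ENNReal.ofReal_natCast, ← ENNReal.ofReal_mul (add_nonneg rate_nonneg (by positivity))]
      refine ENNReal.ofReal_le_ofReal ?_
      have := hn 0 n (by omega) le_rfl
      push_cast at this
      linarith
    refine ge_of_tendsto' (x := atTop) (ENNReal.tendsto_ofReal ?_) hk
    simpa using (tendsto_one_div_add_atTop_nhds_zero_nat (𝕜 := ℝ)).const_add (rate f μ)
  have hlow : ∀ x, lowerRate f 0 x = liminf (fun n : ℕ => (f 0 n x : ℝ≥0∞) / n) atTop :=
    fun x => by simp [lowerRate]
  -- The lower limit is at most the constant `rate` almost surely, while its integral is at least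
  -- that constant; so the two agree.
  have hinf : lowerRate f 0 =ᵐ[μ] fun _ => ENNReal.ofReal (rate f μ) := by
    refine ae_eq_of_ae_le_of_lintegral_le ?_
      ((hf.lintegral_lowerRate_le_two 0).trans_lt (by simp)).ne aemeasurable_const ?_
    · filter_upwards [hsup] with x hx
      rw [hlow]
      exact (liminf_le_limsup (by isBoundedDefault) (by isBoundedDefault)).trans hx
    · simpa using hf.rate_le_lintegral hμ
  filter_upwards [hsup, hinf] with x h1 h2
  have := tendsto_of_le_liminf_of_limsup_le (h2.symm.trans (hlow x)).le h1
  have := (ENNReal.tendsto_toReal ENNReal.ofReal_ne_top).comp this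
  rw [ENNReal.toReal_ofReal rate_nonneg] at this
  refine this.congr fun n => ?_
  simp

end LocalSubadditive

end LineModel

open scoped ENNReal

namespace LineModel

/-! ### The canonical model -/

/-- The weights of a configuration of edges. -/
noncomputable def weights (x : Edge → Bool) (i j : ℤ) : EReal :=
  if h : i < j then (if x ⟨(i, j), h⟩ then 1 else ⊥) else ⊥

theorem weights_eq_one_iff {x : Edge → Bool} {i j : ℤ} :
    weights x i j = 1 ↔ ∃ h : i < j, x ⟨(i, j), h⟩ = true := by
  have hbot : (⊥ : EReal) ≠ 1 := EReal.bot_ne_coe 1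
  unfold weights
  split_ifs with h1 h2
  · simp [h1, h2]
  · simp [h1, h2, hbot]
  · simp [h1, hbot]

theorem weights_translate {x : Edge → Bool} {m u v : ℤ} :
    weights (translate m x) u v = 1 ↔ weights x (u + m) (v + m) = 1 := by
  rw [weights_eq_one_iff, weights_eq_one_iff]
  exact ⟨fun ⟨h, hx⟩ => ⟨by omega, hx⟩, fun ⟨h, hx⟩ => ⟨by omega, hx⟩⟩

theorem weights_translate_neg {x : Edge → Bool} {m u v : ℤ} :
    weights x u v = 1 ↔ weights (translate m x) (u + -m) (v + -m) = 1 := by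
  rw [weights_translate, neg_add_cancel_right, neg_add_cancel_right]

theorem weights_congr {x y : Edge → Bool} {u v : ℤ} (h : ∀ h : u < v, x ⟨(u, v), h⟩ = y ⟨(u, v), h⟩) :
    weights x u v = 1 ↔ weights y u v = 1 := by
  rw [weights_eq_one_iff, weights_eq_one_iff]
  exact exists_congr fun hlt => by rw [h hlt]

/-- Adding 1 to `L` absorbs the edge lost in `L_le_add`. -/
theorem localSubadditive_L : LocalSubadditive fun i j x => L (weights x) i j + 1 where
  le_add x hij hjk := by
    have := L_le_add (a := weights x) hij hjk
    omega
  le x hij := by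
    have := L_le (a := weights x) hij
    push_cast
    omega
  dependsOn hij x y hxy := congrArg (· + 1) <|
    L_congr hij fun u v h1 h2 h3 => weights_congr fun h => hxy _ ⟨h1, h3⟩
  translate {i j} m x hij := by
    refine congrArg (· + 1) (le_antisymm
      (L_translate_le hij fun u v _ => weights_translate.1) ?_)
    have := L_translate_le (a := weights x) (b := weights (LineModel.translate m x)) (m := -m)
      (i := i + m) (j := j + m) (by omega) fun u v _ => weights_translate_neg.1
    simpa using this

theorem localSubadditive_numGood : LocalSubadditive fun i j x => numGood (weights x) i j where
  le_add x hij hjk := numGood_le_add hij hjk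
  le x hij := numGood_le hij
  dependsOn hij x y hxy :=
    numGood_congr fun u v h1 h2 h3 => weights_congr fun h => hxy _ ⟨h1, h3⟩
  translate {i j} m x hij := by
    refine le_antisymm (numGood_translate_le fun u v _ => weights_translate.1) ?_
    have := numGood_translate_le (a := weights x) (b := weights (LineModel.translate m x))
      (m := -m) (i := i + m) (j := j + m) fun u v _ => weights_translate_neg.1
    simpa using this

/-- The law of the state of a pair at distance `k`. -/
noncomputable def edgeLaw (p : ℕ → ℝ) (k : ℕ) : Measure Bool :=
  ENNReal.ofReal (p k) • Measure.dirac true + ENNReal.ofReal (1 - p k) • Measure.dirac false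

/-- The law of the configuration of edges. -/
noncomputable def modelLaw (p : ℕ → ℝ) : Measure (Edge → Bool) :=
  Measure.infinitePi fun e : Edge => edgeLaw p (e.1.2 - e.1.1).toNat

variable {p : ℕ → ℝ}

theorem edgeLaw_true (k : ℕ) : edgeLaw p k {true} = ENNReal.ofReal (p k) := by
  simp [edgeLaw]

theorem edgeLaw_false (k : ℕ) : edgeLaw p k {false} = ENNReal.ofReal (1 - p k) := by
  simp [edgeLaw]

theorem isProbabilityMeasure_edgeLaw (hp : ∀ k : ℕ, 1 ≤ k → 0 ≤ p k ∧ p k < 1) (e : Edge) :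
    IsProbabilityMeasure (edgeLaw p (e.1.2 - e.1.1).toNat) := by
  obtain ⟨h0, h1⟩ := hp (e.1.2 - e.1.1).toNat (by have := e.2; omega)
  constructor
  simp [edgeLaw, ← ENNReal.ofReal_add h0 (sub_nonneg.2 h1.le)]

theorem isProbabilityMeasure_modelLaw (hp : ∀ k : ℕ, 1 ≤ k → 0 ≤ p k ∧ p k < 1) :
    IsProbabilityMeasure (modelLaw p) := by
  have := isProbabilityMeasure_edgeLaw hp
  unfold modelLaw
  infer_instance

theorem iIndepFun_modelLaw (hp : ∀ k : ℕ, 1 ≤ k → 0 ≤ p k ∧ p k < 1) :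
    iIndepFun (fun (e : Edge) (x : Edge → Bool) => x e) (modelLaw p) := by
  have := isProbabilityMeasure_edgeLaw hp
  exact iIndepFun_infinitePi (X := fun (e : Edge) (b : Bool) => b) fun _ => measurable_id

theorem measurePreserving_translate (hp : ∀ k : ℕ, 1 ≤ k → 0 ≤ p k ∧ p k < 1) (m : ℤ) :
    MeasurePreserving (translate m) (modelLaw p) (modelLaw p) := by
  have := isProbabilityMeasure_edgeLaw hp
  refine ⟨by unfold translate; fun_prop, ?_⟩
  have hinj : Function.Injective fun e : Edge =>
      (⟨(e.1.1 + m, e.1.2 + m), by simpa using e.2⟩ : Edge) := by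
    rintro ⟨⟨u, v⟩, h⟩ ⟨⟨u', v'⟩, h'⟩ heq
    simpa using heq
  have := Measure.map_infinitePi_infinitePi_of_inj
    (P := fun e : Edge => edgeLaw p (e.1.2 - e.1.1).toNat) hinj
  refine this.trans (congrArg Measure.infinitePi (funext fun e => ?_))
  dsimp only
  rw [add_sub_add_right_eq_sub]

theorem modelLaw_forall (hp : ∀ k : ℕ, 1 ≤ k → 0 ≤ p k ∧ p k < 1) (n : ℕ) (e : ℕ → Edge)
    (he : Function.Injective e) (b : Bool) :
    modelLaw p {x | ∀ m < n, x (e m) = b} =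
      ∏ m ∈ Finset.range n, edgeLaw p ((e m).1.2 - (e m).1.1).toNat {b} := by
  have := isProbabilityMeasure_edgeLaw hp
  have h := Measure.infinitePi_pi (μ := fun e : Edge => edgeLaw p (e.1.2 - e.1.1).toNat)
    (s := (Finset.range n).map ⟨e, he⟩) (t := fun _ => {b}) fun _ _ => measurableSet_singleton b
  rw [Finset.prod_map] at h
  refine Eq.trans ?_ h
  rw [modelLaw]
  congr 1
  ext x
  simp [Set.mem_pi]

/-! ### Good points have a positive density -/

/-- The probability that a point has no edge from the `k` points before it. -/
noncomputable def gapProb (p : ℕ → ℝ) (k : ℕ) : ℝ≥0∞ :=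
  ∏ m ∈ Finset.range k, ENNReal.ofReal (1 - p (m + 1))

theorem tsum_gapProb_ne_top (hp : ∀ k : ℕ, 1 ≤ k → 0 ≤ p k ∧ p k < 1)
    (hC2 : Summable fun k : ℕ => ∏ m ∈ Finset.Icc 1 (k + 1), (1 - p m)) :
    ∑' k, gapProb p k ≠ ∞ := by
  have h0 : ∀ m, 0 ≤ 1 - p (m + 1) := fun m => sub_nonneg.2 (hp (m + 1) (by omega)).2.le
  have hs : Summable fun k : ℕ => ∏ m ∈ Finset.range k, (1 - p (m + 1)) := by
    rw [← summable_nat_add_iff 1]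
    refine hC2.congr fun k => ?_
    rw [Finset.range_eq_Ico, Finset.prod_Ico_add' (fun m => 1 - p m)]
    rfl
  have : ∀ k, gapProb p k = ENNReal.ofReal (∏ m ∈ Finset.range k, (1 - p (m + 1))) :=
    fun k => (ENNReal.ofReal_prod_of_nonneg fun m _ => h0 m).symm
  simp_rw [this]
  exact hs.tsum_ofReal_ne_top

theorem modelLaw_no_edge_to (hp : ∀ k : ℕ, 1 ≤ k → 0 ≤ p k ∧ p k < 1) (t : ℤ) (k : ℕ) :
    modelLaw p {x | ∀ u, t ≤ u → u < t + k → weights x u (t + k) ≠ 1} ≤ gapProb p k := by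
  have h := modelLaw_forall hp k (fun m => ⟨(t + k - (m + 1 : ℕ), t + k), by push_cast; omega⟩)
    (fun m m' h => by simpa using h) false
  refine (measure_mono fun x hx m hm => ?_).trans (h.le.trans (le_of_eq ?_))
  · have := hx (t + k - (m + 1 : ℕ)) (by omega) (by omega)
    rw [Ne, weights_eq_one_iff, not_exists] at this
    simpa using this (by omega)
  · refine Finset.prod_congr rfl fun m _ => ?_
    rw [edgeLaw_false]
    congr
    dsimp only
    omega

theorem modelLaw_no_edge_from (hp : ∀ k : ℕ, 1 ≤ k → 0 ≤ p k ∧ p k < 1) (t : ℤ) (k : ℕ) :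
    modelLaw p {x | ∀ v, t - k < v → v ≤ t → weights x (t - k) v ≠ 1} ≤ gapProb p k := by
  have h := modelLaw_forall hp k (fun m => ⟨(t - k, t - k + (m + 1 : ℕ)), by push_cast; omega⟩)
    (fun m m' h => by simpa using h) false
  refine (measure_mono fun x hx m hm => ?_).trans (h.le.trans (le_of_eq ?_))
  · have := hx (t - k + (m + 1 : ℕ)) (by omega) (by omega)
    rw [Ne, weights_eq_one_iff, not_exists] at this
    simpa using this (by omega)
  · refine Finset.prod_congr rfl fun m _ => ?_
    rw [edgeLaw_false]
    congr
    dsimp only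
    omega

theorem modelLaw_chain (hp : ∀ k : ℕ, 1 ≤ k → 0 ≤ p k ∧ p k < 1) (t : ℤ) (n : ℕ) :
    ENNReal.ofReal (p 1) ^ n ≤
      modelLaw p {x | ∀ u, t ≤ u → u < t + n → weights x u (u + 1) = 1} := by
  have h := modelLaw_forall hp n (fun m => ⟨(t + m, t + m + 1), by simp⟩)
    (fun m m' h => by simpa using h) true
  refine le_trans (le_of_eq ?_) (h.ge.trans (measure_mono fun x hx u h1 h2 => ?_))
  · simp [edgeLaw_true]
  · have := hx (u - t).toNat (by omega)
    simp only [show t + ((u - t).toNat : ℤ) = u by omega] at this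
    exact weights_eq_one_iff.2 ⟨by omega, this⟩

theorem exists_le_modelLaw_good (hp : ∀ k : ℕ, 1 ≤ k → 0 ≤ p k ∧ p k < 1) (hC1 : 0 < p 1)
    (hC2 : Summable fun k : ℕ => ∏ m ∈ Finset.Icc 1 (k + 1), (1 - p m)) :
    ∃ ρ : ℝ≥0∞, 0 < ρ ∧ ∀ i j t : ℤ, i ≤ t → t ≤ j →
      ρ ≤ modelLaw p {x | Good (weights x) i j t} := by
  have := isProbabilityMeasure_modelLaw hp
  -- `K` depends only on `p`, so the resulting `ρ` is uniform in `i`, `j` and `t`.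
  obtain ⟨K, hK⟩ := ((ENNReal.tendsto_sum_nat_add _ (tsum_gapProb_ne_top hp hC2)).eventually_lt_const
    (show (0 : ℝ≥0∞) < 1 / 4 by simp)).exists
  refine ⟨ENNReal.ofReal (p 1) ^ (2 * K) * 2⁻¹,
    ENNReal.mul_pos (ENNReal.pow_pos (ENNReal.ofReal_pos.2 hC1) _).ne' (by simp), fun i j t hit htj => ?_⟩
  -- `H` makes the window of radius `K` around `t` a chain of unit edges; `F` is the goodness
  -- condition for points outside it. They involve disjoint sets of edges, hence are independent,
  -- and a union bound gives `F` probability at least 1/2.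
  let H : (Edge → Bool) → Prop := fun x =>
    ∀ u, t - K ≤ u → u < t - K + (2 * K : ℕ) → weights x u (u + 1) = 1
  let F : (Edge → Bool) → Prop := fun x =>
    (∀ v, t + K < v → v ≤ j → ∃ u, t ≤ u ∧ u < v ∧ weights x u v = 1) ∧
    (∀ u, i ≤ u → u < t - K → ∃ v, u < v ∧ v ≤ t ∧ weights x u v = 1)
  have hH : DependsOn H (edgesIn (t - K) (t + K)) := fun x y hxy => by
    exact propext (forall₃_congr fun u h1 h2 => weights_congr fun h =>
      hxy _ ⟨h1, by dsimp only; push_cast at h2; omega⟩)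
  have hF : DependsOn F (edgesIn i j \ edgesIn (t - K) (t + K)) := fun x y hxy => by
    refine congrArg₂ And ?_ ?_
    · refine propext (forall₃_congr fun v h1 h2 => exists_congr fun u => and_congr_right fun h3 =>
        and_congr_right fun h4 => weights_congr fun h => hxy _ ⟨⟨by dsimp only; omega, h2⟩, ?_⟩)
      rintro ⟨h5, h6⟩
      dsimp only at h5 h6
      omega
    · refine propext (forall₃_congr fun u h1 h2 => exists_congr fun v => and_congr_right fun h3 =>
        and_congr_right fun h4 => weights_congr fun h => hxy _ ⟨⟨h1, by dsimp only; omega⟩, ?_⟩)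
      rintro ⟨h5, h6⟩
      dsimp only at h5 h6
      omega
  have hFm : MeasurableSet {x | F x} :=
    measurableSet_setOfPred.2 (measurable_of_dependsOn ((finite_edgesIn i j).sdiff) hF)
  have hind := (indepFun_of_dependsOn (iIndepFun_modelLaw hp) (finite_edgesIn _ _)
    ((finite_edgesIn i j).sdiff) hH hF Set.disjoint_sdiff_right).measure_inter_preimage_eq_mul
      {True} {True} (measurableSet_singleton _) (measurableSet_singleton _)
  have eH : H ⁻¹' {True} = {x | H x} := by ext x; simp
  have eF : F ⁻¹' {True} = {x | F x} := by ext x; simp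
  rw [eH, eF] at hind
  have hFc : modelLaw p {x | F x}ᶜ ≤ 2⁻¹ := by
    have hsub : {x | F x}ᶜ ⊆
        (⋃ k : ℕ, {x | ∀ u, t ≤ u → u < t + (k + K : ℕ) → weights x u (t + (k + K : ℕ)) ≠ 1}) ∪
        ⋃ k : ℕ, {x | ∀ v, t - (k + K : ℕ) < v → v ≤ t → weights x (t - (k + K : ℕ)) v ≠ 1} := by
      intro x hx
      simp only [Set.mem_compl_iff, Set.mem_ofPred_eq, F, not_and_or] at hx
      push Not at hx
      rcases hx with ⟨v, h1, h2, h3⟩ | ⟨u, h1, h2, h3⟩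
      · refine Or.inl (Set.mem_iUnion.2 ⟨(v - t - K).toNat, ?_⟩)
        rw [Set.mem_ofPred_eq, show t + (((v - t - K).toNat + K : ℕ) : ℤ) = v by omega]
        exact h3
      · refine Or.inr (Set.mem_iUnion.2 ⟨(t - u - K).toNat, ?_⟩)
        rw [Set.mem_ofPred_eq, show t - (((t - u - K).toNat + K : ℕ) : ℤ) = u by omega]
        exact h3
    calc modelLaw p {x | F x}ᶜ ≤ ∑' k, gapProb p (k + K) + ∑' k, gapProb p (k + K) := by
          refine (measure_mono hsub).trans ((measure_union_le _ _).trans (add_le_add ?_ ?_))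
          · exact (measure_iUnion_le _).trans
              (ENNReal.tsum_le_tsum fun k => modelLaw_no_edge_to hp t (k + K))
          · exact (measure_iUnion_le _).trans
              (ENNReal.tsum_le_tsum fun k => modelLaw_no_edge_from hp t (k + K))
      _ ≤ 1 / 4 + 1 / 4 := add_le_add hK.le hK.le
      _ = 2⁻¹ := by
          rw [← ENNReal.toReal_eq_toReal_iff' (by finiteness) (by finiteness),
            ENNReal.toReal_add (by finiteness) (by finiteness)]
          norm_num
  have hF2 : 2⁻¹ ≤ modelLaw p {x | F x} := by
    rw [prob_compl_eq_one_sub hFm, tsub_le_iff_left, ← tsub_le_iff_right] at hFc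
    simpa using hFc
  have hsub : {x | H x} ∩ {x | F x} ⊆ {x | Good (weights x) i j t} := by
    rintro x ⟨hHx, hFx⟩
    refine ⟨fun v h1 h2 => ?_, fun u h1 h2 => ?_⟩
    · rcases lt_or_ge (t + K) v with h | h
      · exact hFx.1 v h h2
      · exact ⟨v - 1, by omega, by omega, by
          simpa using hHx (v - 1) (by omega) (by push_cast; omega)⟩
    · rcases lt_or_ge u (t - K) with h | h
      · exact hFx.2 u h1 h
      · exact ⟨u + 1, by omega, by omega, hHx u h (by push_cast; omega)⟩
  calc ENNReal.ofReal (p 1) ^ (2 * K) * 2⁻¹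
      ≤ modelLaw p {x | H x} * modelLaw p {x | F x} :=
        mul_le_mul' (modelLaw_chain hp (t - K) (2 * K)) hF2
    _ = modelLaw p ({x | H x} ∩ {x | F x}) := hind.symm
    _ ≤ _ := measure_mono hsub

/-- By linearity of expectation, the mean number of good points is at least `ρ` times the number of
points. -/
theorem rate_numGood_pos (hp : ∀ k : ℕ, 1 ≤ k → 0 ≤ p k ∧ p k < 1) (hC1 : 0 < p 1)
    (hC2 : Summable fun k : ℕ => ∏ m ∈ Finset.Icc 1 (k + 1), (1 - p m)) :
    0 < rate (fun i j x => numGood (weights x) i j) (modelLaw p) := by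
  classical
  have := isProbabilityMeasure_modelLaw hp
  obtain ⟨ρ, hρ0, hρ⟩ := exists_le_modelLaw_good hp hC1 hC2
  have hρt : ρ ≠ ∞ := ((hρ 0 0 0 le_rfl le_rfl).trans_lt (measure_lt_top _ _)).ne
  refine (ENNReal.toReal_pos hρ0.ne' hρt).trans_le (le_ciInf fun n => ?_)
  rw [le_div_iff₀ (by positivity)]
  have hm : ∀ t ∈ Finset.Icc (0 : ℤ) (n + 1),
      MeasurableSet {x | Good (weights x) 0 (n + 1) t} := fun t ht => by
    rw [Finset.mem_Icc] at ht
    refine measurableSet_setOfPred.2 (measurable_of_dependsOn (finite_edgesIn 0 (n + 1))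
      fun x y hxy => propext ⟨fun h => ?_, fun h => ?_⟩)
    · exact h.congr ht.1 ht.2 fun u v h1 h2 h3 => (weights_congr fun h => hxy _ ⟨h1, h3⟩).1
    · exact h.congr ht.1 ht.2 fun u v h1 h2 h3 => (weights_congr fun h => hxy _ ⟨h1, h3⟩).2
  have hsum : ∀ x, (numGood (weights x) 0 (n + 1) : ℝ) = ∑ t ∈ Finset.Icc (0 : ℤ) (n + 1),
      {x | Good (weights x) 0 (n + 1) t}.indicator (fun _ => 1) x := fun x => by
    simp [numGood, Set.indicator_apply]
  simp_rw [hsum]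
  rw [integral_finsetSum _ fun t ht => (integrable_const (1 : ℝ)).indicator (hm t ht)]
  calc ρ.toReal * (n + 1) ≤ ρ.toReal * (n + 2) := by gcongr; norm_num
    _ = ∑ t ∈ Finset.Icc (0 : ℤ) (n + 1), ρ.toReal := by
      rw [Finset.sum_const, Int.card_Icc, nsmul_eq_mul, mul_comm,
        show ((n : ℤ) + 1 + 1 - 0).toNat = n + 2 by omega]
      push_cast
      rfl
    _ ≤ _ := Finset.sum_le_sum fun t ht => by
      refine le_of_le_of_eq ?_ (integral_indicator_one (hm t ht)).symm
      rw [Finset.mem_Icc] at ht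
      exact ENNReal.toReal_mono (measure_ne_top _ _) (hρ _ _ _ ht.1 ht.2)

/-! ### The limits in the canonical model -/

theorem eventually_L_le_T (hp : ∀ k : ℕ, 1 ≤ k → 0 ≤ p k ∧ p k < 1) (hC1 : 0 < p 1)
    (hC2 : Summable fun k : ℕ => ∏ m ∈ Finset.Icc 1 (k + 1), (1 - p m)) {ε : ℝ} (hε : 0 < ε) :
    ∀ᵐ x ∂modelLaw p, ∀ᶠ n : ℕ in atTop,
      (L (weights x) 0 n : ℝ) ≤ T (weights x) 0 n + ε * n := by
  have := isProbabilityMeasure_modelLaw hp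
  set ρ := rate (fun i j x => numGood (weights x) i j) (modelLaw p) with hρ
  have hρ0 : 0 < ρ := rate_numGood_pos hp hC1 hC2
  -- The bound `η ≤ 1 / 2` keeps the end segments of length `j ≤ η * n` from overlapping. The bound
  -- `η ≤ ε / 4` gives `2 * j + 2 ≤ 3 * η * n ≤ ε * n` once `η * n > 2`.
  obtain ⟨η, hη0, hη1, hη2⟩ : ∃ η : ℝ, 0 < η ∧ η ≤ ε / 4 ∧ η ≤ 1 / 2 :=
    ⟨min (ε / 4) (1 / 2), by positivity, min_le_left _ _, min_le_right _ _⟩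
  -- Removing an end segment lowers the main term by `ρ * j > ρ * η * n / 2`, which is twice the
  -- error `δ * n`; hence the count strictly drops.
  have hδ : 0 < ρ * η / 4 := by positivity
  filter_upwards [localSubadditive_numGood.eventually_le (iIndepFun_modelLaw hp)
    (measurePreserving_translate hp) hδ, localSubadditive_numGood.tendsto_div
    (iIndepFun_modelLaw hp) (measurePreserving_translate hp)] with x hx1 hx2
  obtain ⟨n₀, hn₀⟩ := exists_nat_gt (2 / η)
  filter_upwards [hx1, hx2.eventually_const_lt (sub_lt_self ρ hδ), eventually_ge_atTop (n₀ + 1)]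
    with n h1 h2 hn
  have hnpos : (0 : ℝ) < n := by exact_mod_cast (by omega : 0 < n)
  have hηn : 2 < η * n := by
    rw [div_lt_iff₀ hη0] at hn₀
    have : (n₀ : ℝ) ≤ n := by exact_mod_cast (by omega : n₀ ≤ n)
    nlinarith
  rw [lt_div_iff₀ hnpos] at h2
  set j := ⌊η * n⌋₊ with hj
  have hj1 : (j : ℝ) ≤ η * n := Nat.floor_le (by positivity)
  have hj2 : η * n < j + 1 := Nat.lt_floor_add_one _
  have hjn : 2 * j ≤ n := by
    have : (2 * j : ℝ) ≤ n := by nlinarith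
    exact_mod_cast this
  have hcast : ((n - j : ℕ) : ℝ) = n - j := Nat.cast_sub (by omega)
  have hρj : ρ * (η * n) < ρ * (j + 1) := by gcongr
  have hkey : ρ * 2 < ρ * (η * n) := by gcongr
  obtain ⟨s, hs0, hsj, hsn, hs⟩ := exists_good_lt (a := weights x) (i := 0) (j := j) (k := n)
    (by simp) (by
      have := h1 j n (by omega) le_rfl
      have h : (numGood (weights x) j n : ℝ) < numGood (weights x) 0 n := by
        refine this.trans_lt (lt_of_le_of_lt ?_ h2)
        linarith
      exact_mod_cast h)
  obtain ⟨t, ht0, htj, htn, ht⟩ := exists_good_gt (a := weights x) (i := 0) (j := (n - j : ℕ))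
    (k := n) (by omega) (by
      have := h1 0 (n - j) (by omega) (by omega)
      have h : (numGood (weights x) (0 : ℕ) (n - j : ℕ) : ℝ) < numGood (weights x) 0 n := by
        refine this.trans_lt (lt_of_le_of_lt ?_ h2)
        rw [hcast, Nat.cast_zero]
        linarith
      exact_mod_cast h)
  have hLT := L_le_T_of_good hs ht hs0 (by omega) htn
  have hLT' : L (weights x) 0 n ≤ T (weights x) 0 n + 2 * j + 2 := by omega
  have hLT'' : (L (weights x) 0 n : ℝ) ≤ T (weights x) 0 n + 2 * j + 2 := by exact_mod_cast hLT'
  nlinarith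

theorem tendsto_L (hp : ∀ k : ℕ, 1 ≤ k → 0 ≤ p k ∧ p k < 1) :
    ∀ᵐ x ∂modelLaw p, Tendsto (fun n : ℕ => (L (weights x) 0 n : ℝ) / n) atTop
      (𝓝 (rate (fun i j x => L (weights x) i j + 1) (modelLaw p))) := by
  have := isProbabilityMeasure_modelLaw hp
  filter_upwards [localSubadditive_L.tendsto_div (iIndepFun_modelLaw hp)
    (measurePreserving_translate hp)] with x hx
  have := hx.sub tendsto_one_div_atTop_nhds_zero_nat
  rw [sub_zero] at this
  refine this.congr fun n => ?_
  push_cast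
  ring

theorem tendsto_T (hp : ∀ k : ℕ, 1 ≤ k → 0 ≤ p k ∧ p k < 1) (hC1 : 0 < p 1)
    (hC2 : Summable fun k : ℕ => ∏ m ∈ Finset.Icc 1 (k + 1), (1 - p m)) :
    ∀ᵐ x ∂modelLaw p, Tendsto (fun n : ℕ => (T (weights x) 0 n : ℝ) / n) atTop
      (𝓝 (rate (fun i j x => L (weights x) i j + 1) (modelLaw p))) := by
  filter_upwards [tendsto_L hp, ae_all_iff.2 fun k : ℕ =>
    eventually_L_le_T hp hC1 hC2 (ε := 1 / (k + 1)) (by positivity)] with x hL hx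
  have hdiff : Tendsto (fun n : ℕ => (L (weights x) 0 n : ℝ) / n - (T (weights x) 0 n : ℝ) / n)
      atTop (𝓝 0) := by
    rw [Metric.tendsto_nhds]
    intro ε hε
    obtain ⟨k, hk⟩ := exists_nat_one_div_lt hε
    filter_upwards [hx k, eventually_ge_atTop 1] with n hn hn1
    have hnpos : (0 : ℝ) < n := by exact_mod_cast hn1
    have hTL : (T (weights x) 0 n : ℝ) ≤ L (weights x) 0 n := by
      exact_mod_cast T_le_L (a := weights x) le_rfl (by simp) le_rfl
    rw [Real.dist_0_eq_abs, ← sub_div, abs_of_nonneg (div_nonneg (by linarith) hnpos.le)]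
    refine lt_of_le_of_lt ?_ hk
    rw [div_le_iff₀ hnpos]
    linarith
  simpa using hL.sub hdiff

/-! ### Transfer to an arbitrary line model -/

open Classical in
/-- The configuration of the edges of a line model. -/
noncomputable def config {Ω : Type*} (α : ℤ → ℤ → Ω → EReal) (ω : Ω) : Edge → Bool :=
  fun e => decide (α e.1.1 e.1.2 ω = 1)

theorem weights_config {Ω : Type*} {α : ℤ → ℤ → Ω → EReal} {ω : Ω} {u v : ℤ} (h : u < v) :
    weights (config α ω) u v = 1 ↔ α u v ω = 1 := by
  simp [weights_eq_one_iff, config, h]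

theorem IsLineModel.measurePreserving_config {Ω : Type*} [MeasurableSpace Ω] {P : Measure Ω}
    [IsProbabilityMeasure P] {α : ℤ → ℤ → Ω → EReal} (hα : IsLineModel p P α)
    (hp : ∀ k : ℕ, 1 ≤ k → 0 ≤ p k ∧ p k < 1) :
    MeasurePreserving (config α) P (modelLaw p) := by
  classical
  have hd : Measurable fun y : EReal => decide (y = 1) :=
    measurable_to_bool (by
      have : (fun y : EReal => decide (y = 1)) ⁻¹' {true} = {1} := by ext y; simp
      rw [this]
      exact measurableSet_singleton _)
  have hm : ∀ e : Edge, Measurable fun ω => config α ω e :=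
    fun e => hd.comp (hα.measurable _ _ e.2)
  have hi : iIndepFun (fun (e : Edge) ω => config α ω e) P :=
    hα.indep.comp (fun _ y => decide (y = 1)) fun _ => hd
  refine ⟨measurable_pi_iff.2 hm, ?_⟩
  -- Independence makes the law of the configuration a product, so only the marginals remain to be
  -- compared.
  have hmap : P.map (config α) = _ := hi.map_fun_eq_infinitePi_map hm
  rw [hmap, modelLaw]
  congr with e : 1
  have htrue : P.map (fun ω => config α ω e) {true} =
      edgeLaw p (e.1.2 - e.1.1).toNat {true} := by
    rw [Measure.map_apply (hm e) (measurableSet_singleton _), edgeLaw_true,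
      ← hα.prob_one _ _ e.2]
    congr 1
    ext ω
    simp [config]
  have := isProbabilityMeasure_edgeLaw hp e
  have := Measure.isProbabilityMeasure_map (μ := P) (hm e).aemeasurable
  refine Measure.ext_of_singleton fun b => ?_
  cases b
  · have h : ({false} : Set Bool) = {true}ᶜ := by ext b; simp
    rw [h, prob_compl_eq_one_sub (measurableSet_singleton _),
      prob_compl_eq_one_sub (measurableSet_singleton _), htrue]
  · exact htrue

end LineModel

theorem mainTheorem6 (p : ℕ → ℝ) (hp : ∀ k : ℕ, 1 ≤ k → 0 ≤ p k ∧ p k < 1)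
    (hC1 : 0 < p 1 ∧ p 1 < 1)
    (hC2 : Summable fun k : ℕ => ∏ m ∈ Finset.Icc 1 (k + 1), (1 - p m)) :
    ∃ C : ℝ, 0 ≤ C ∧ C ≤ 1 ∧
      ∀ (Ω : Type*) [MeasurableSpace Ω] (P : Measure Ω) [IsProbabilityMeasure P]
        (α : ℤ → ℤ → Ω → EReal), LineModel.IsLineModel p P α →
        (∀ᵐ ω ∂P, Tendsto (fun n : ℕ => (LineModel.L (fun i j => α i j ω) 0 n : ℝ) / n)
          atTop (𝓝 C)) ∧
        (∀ᵐ ω ∂P, Tendsto (fun n : ℕ => (LineModel.T (fun i j => α i j ω) 0 n : ℝ) / n)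
          atTop (𝓝 C)) := by
  have := LineModel.isProbabilityMeasure_modelLaw hp
  refine ⟨LineModel.rate (fun i j x => LineModel.L (LineModel.weights x) i j + 1)
    (LineModel.modelLaw p), LineModel.rate_nonneg, ?_, fun Ω _ P _ α hα => ⟨?_, ?_⟩⟩
  -- An almost sure event of a probability space is nonempty, so one configuration suffices to bound
  -- the constant.
  · obtain ⟨x, hx⟩ := (LineModel.tendsto_L hp).exists
    refine le_of_tendsto' hx fun n => div_le_one_of_le₀ ?_ (Nat.cast_nonneg n)
    have := LineModel.L_le (a := LineModel.weights x) (i := 0) (j := n) (by simp)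
    exact_mod_cast (by omega : LineModel.L (LineModel.weights x) 0 n ≤ n)
  · filter_upwards [(hα.measurePreserving_config hp).quasiMeasurePreserving.ae
      (LineModel.tendsto_L hp)] with ω hω
    refine hω.congr fun n => ?_
    rw [LineModel.L_congr (b := fun i j => α i j ω) (by simp)
      fun u v _ h _ => LineModel.weights_config h]
  · filter_upwards [(hα.measurePreserving_config hp).quasiMeasurePreserving.ae
      (LineModel.tendsto_T hp hC1.1 hC2)] with ω hω
    refine hω.congr fun n => ?_
    rw [LineModel.T_congr (b := fun i j => α i j ω)
      fun u v _ h _ => LineModel.weights_config h]
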